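/- All rings are commutative and Noetherian and all modules are finitely generated. Let $R$ be a local ring with maximal ideal $\mathfrak m$ and write $(-)^*=\operatorname{Hom}_R(-,R)$. For an $R$-module $X$ with minimal free resolution $(\cdots\xrightarrow{d_2}F_1\xrightarrow{d_1}F_0\to 0)$ and $n\ge 0$, put $\Omega^n X=\operatorname{Coker} d_{n+1}$. Write $X\approx Y$ if there are projective $R$-modules $P,Q$ with $X\oplus P\cong Y\oplus Q$. The grade of $X$ is $\inf\{i\ge 0 : \operatorname{Ext}_R^i(X,R)\neq 0\}$. The module $X$ is totally reflexive if the natural map $X\to X^{**}$ is an isomorphism and $\operatorname{Ext}^i_R(X,R)=\operatorname{Ext}^i_R(X^*,R)=0$ for all $i>0$; the Gorenstein dimension of $X$ is the infimum of the $n\ge 0$ for which there is an exact sequence $0\to G_n\to\cdots\to G_0\to X\to 0$ with all $G_k$ totally reflexive; and $X$ is G-perfect if $X\ne 0$ and its grade equals its Gorenstein dimension. For an integer $a>0$, a complex $F=(\cdots\xrightarrow{d_2}F_1\xrightarrow{d_1}F_0\to0)$ is eventually periodic with period $a$ if there are an integer $n\ge 0$ and a map $e\colon F_n\to F_{n+a-1}$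 such that $F$ is isomorphic to a complex of the form $$\cdots\xrightarrow{e}F_{n+a-1}\xrightarrow{d_{n+a-1}}\cdots\xrightarrow{d_{n+1}}F_n\xrightarrow{e}F_{n+a-1}\xrightarrow{d_{n+a-1}}\cdots\xrightarrow{d_{n+1}}F_n\xrightarrow{d_n}F_{n-1}\xrightarrow{d_{n-1}}\cdots\xrightarrow{d_1}F_0\to 0 .$$ **Theorem.** Let $M$ be a G-perfect $R$-module of grade $g$, let $F$ be a minimal free resolution of $M$, and set $N=\operatorname{Ext}_R^g(M,R)$. 1. If $F$ is eventually periodic with period $a>0$, then $(\Omega^i N)^*\approx\Omega^{g+ma-i}M$ for all integers $i\ge g$ and $m\ge \frac ia$. 2. If there are integers $i\ge g$ and $j\ge 0$ such that $i+j>g$ and $(\Omega^i N)^*\approx\Omega^j M$, then $F$ is eventually periodic with period $i+j-g$. -/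

import Mathlib

open CategoryTheory

universe u

noncomputable section

namespace GPerfect

/-- `Extⁱ_R(M, N)`, an `R`-module (all modules live in the universe of `R`). -/
abbrev ExtMod (R : Type u) [CommRing R] (M N : Type u) [AddCommGroup M] [Module R M]
    [AddCommGroup N] [Module R N] (i : ℕ) : Type u :=
  Abelian.Ext (ModuleCat.of R M) (ModuleCat.of R N) i

/-- The grade of `M`: the infimum of all `i` with `Extⁱ_R(M, R) ≠ 0` (and `∞` if there is none). -/
def grade (R : Type u) [CommRing R] (M : Type u) [AddCommGroup M] [Module R M] : ℕ∞ :=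
  ⨅ (i : ℕ) (_ : Nontrivial (ExtMod R M R i)), (i : ℕ∞)

/-- Totally reflexive (finitely generated) modules. -/
structure IsTotallyReflexive (R : Type u) [CommRing R] (M : Type u) [AddCommGroup M]
    [Module R M] : Prop where
  finite : Module.Finite R M
  reflexive : Function.Bijective (Module.Dual.eval R M)
  ext_eq_zero : ∀ i : ℕ, 0 < i → Subsingleton (ExtMod R M R i)
  ext_dual_eq_zero : ∀ i : ℕ, 0 < i → Subsingleton (ExtMod R (Module.Dual R M) R i)

/-- There is an exact sequence `0 → G n → ⋯ → G 0 → M → 0` with all `G k` totally reflexive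
(the sequence is continued to the left by zero modules). -/
def HasTotallyReflexiveResolution (R : Type u) [CommRing R] (M : Type u) [AddCommGroup M]
    [Module R M] (n : ℕ) : Prop :=
  ∃ (G : ℕ → ModuleCat.{u} R) (d : ∀ k, G (k + 1) →ₗ[R] G k) (ε : G 0 →ₗ[R] M),
    (∀ k, k ≤ n → IsTotallyReflexive R (G k)) ∧ (∀ k, n < k → Subsingleton (G k)) ∧
    Function.Surjective ε ∧ Function.Exact (d 0) ε ∧ ∀ k, Function.Exact (d (k + 1)) (d k)

/-- The Gorenstein dimension of `M` (it is `∞` if there is no finite resolution). -/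
def Gdim (R : Type u) [CommRing R] (M : Type u) [AddCommGroup M] [Module R M] : ℕ∞ :=
  ⨅ (n : ℕ) (_ : HasTotallyReflexiveResolution R M n), (n : ℕ∞)

/-- `M` is G-perfect: it is nonzero and its grade equals its Gorenstein dimension. -/
def IsGPerfect (R : Type u) [CommRing R] (M : Type u) [AddCommGroup M] [Module R M] : Prop :=
  Nontrivial M ∧ grade R M = Gdim R M

/-- A projective resolution over a local ring is a minimal free resolution if its terms are free
of finite rank and the image of every differential lies in `𝔪` times its target. -/
structure IsMinimalFree {R : Type u} [CommRing R] [IsLocalRing R] {M : ModuleCat.{u} R}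
    (F : ProjectiveResolution M) : Prop where
  free : ∀ n, Module.Free R (F.complex.X n)
  finite : ∀ n, Module.Finite R (F.complex.X n)
  minimal : ∀ n, LinearMap.range (F.complex.d (n + 1) n).hom ≤
    IsLocalRing.maximalIdeal R • (⊤ : Submodule R (F.complex.X n))

/-- The `n`-th syzygy with respect to the resolution `F`: the cokernel of
`d (n + 1) : F (n + 1) → F n`. -/
abbrev Syzygy {R : Type u} [CommRing R] {M : ModuleCat.{u} R} (F : ProjectiveResolution M)
    (n : ℕ) : Type u :=
  F.complex.X n ⧸ LinearMap.range (F.complex.d (n + 1) n).hom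

/-- `M ≈ N`: there are (finitely generated) projective modules `P`, `Q` with `M ⊕ P ≅ N ⊕ Q`. -/
def StablyIsomorphic (R : Type u) [CommRing R] (M N : Type u) [AddCommGroup M] [Module R M]
    [AddCommGroup N] [Module R N] : Prop :=
  ∃ P Q : ModuleCat.{u} R, Module.Finite R P ∧ Module.Projective R P ∧
    Module.Finite R Q ∧ Module.Projective R Q ∧ Nonempty ((M × P) ≃ₗ[R] (N × Q))

/-- The sequence `0, 1, …, n + a - 1, n, …, n + a - 1, n, …, n + a - 1, …`. -/
def periodicIndex (n a k : ℕ) : ℕ :=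
  if k < n then k else n + (k - n) % a

/-- The differentials of the sequence
`⋯ → (C (n+a-1) → ⋯ → C n) → (C (n+a-1) → ⋯ → C n) → C (n-1) → ⋯ → C 0`:
those of `C`, except that each block is glued to the next one by `e : C n → C (n+a-1)`. -/
def periodicD {R : Type u} [CommRing R] (C : ChainComplex (ModuleCat.{u} R) ℕ) (n a : ℕ)
    (e : C.X n ⟶ C.X (n + a - 1)) (k : ℕ) :
    C.X (periodicIndex n a (k + 1)) ⟶ C.X (periodicIndex n a k) :=
  if h : periodicIndex n a (k + 1) = n ∧ periodicIndex n a k = n + a - 1 then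
    eqToHom (congrArg C.X h.1) ≫ e ≫ eqToHom (congrArg C.X h.2.symm)
  else C.d (periodicIndex n a (k + 1)) (periodicIndex n a k)

/-- `C` is eventually periodic with period `a > 0`: for some `n` it is isomorphic to a complex of
the form `⋯ → (C (n+a-1) → ⋯ → C n) → (C (n+a-1) → ⋯ → C n) → C (n-1) → ⋯ → C 0 → 0`. -/
def IsEventuallyPeriodic {R : Type u} [CommRing R] (C : ChainComplex (ModuleCat.{u} R) ℕ)
    (a : ℕ) : Prop :=
  0 < a ∧ ∃ (n : ℕ) (e : C.X n ⟶ C.X (n + a - 1))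
    (sq : ∀ k, periodicD C n a e (k + 1) ≫ periodicD C n a e k = 0),
    Nonempty (C ≅ ChainComplex.of (fun k => C.X (periodicIndex n a k)) (periodicD C n a e) sq)

end GPerfect

end

/-! Write `T k` for the `k`-th syzygy of `M` and `S i` for the `i`-th syzygy of `N`. The theorem
rests on one fact: for `i ≥ g`, the dual of `S i` is totally reflexive and `T g` is, up to
projective summands, its `i`-th syzygy (`isSyzN_dual_syzygy`).

G-perfection makes `T g` totally reflexive and kills Ext below degree `g`. Dualizing the first `g`
steps of the resolution then shows that `N` is the quotient of the dual of `T g` by a module of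
projective dimension less than `g` (`exists_isShortExact_ext`). That module disappears after `g`
syzygies, so `N` and the dual of `T g` have the same high syzygies. Among totally reflexive modules
duality reverses syzygies, which gives the fact.

Part 1: an `n`-th syzygy determines a totally reflexive module stably
(`IsSyzN.stablyIsomorphic_right`). Periodicity far out therefore descends to all `T k` with `k ≥ g`.
Both the dual of `S i` and `T (g + m * a - i)` have `i`-th syzygy `T g`, hence they agree stably.

Part 2: taking `i`-th syzygies of the hypothesis makes `T g` and `T (i + j)` stably isomorphic.
Minimality makes the next syzygies truly isomorphic. Splicing along this isomorphism gives a
periodic minimal resolution of `M`, and minimal resolutions are unique. -/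

noncomputable section

namespace GPerfect

/-! ### Short exact sequences and the long exact sequence of Ext into `R`. -/

section ShortExact

variable {R : Type u} [CommRing R]

/-- `0 → A → B → C → 0` is exact. -/
structure IsShortExact {A B C : Type u} [AddCommGroup A] [Module R A] [AddCommGroup B] [Module R B]
    [AddCommGroup C] [Module R C] (f : A →ₗ[R] B) (g : B →ₗ[R] C) : Prop where
  inj : Function.Injective f
  exact : Function.Exact f g
  surj : Function.Surjective g

section Ext

variable {A B C : Type u} [AddCommGroup A] [Module R A] [AddCommGroup B] [Module R B]
    [AddCommGroup C] [Module R C] {f : A →ₗ[R] B} {g : B →ₗ[R] C}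

/-- The short complex in `ModuleCat R` of a short exact sequence. -/
abbrev IsShortExact.shortComplex (h : IsShortExact f g) : ShortComplex (ModuleCat.{u} R) :=
  ShortComplex.mk (ModuleCat.ofHom f) (ModuleCat.ofHom g) (by
    ext x; exact h.exact.apply_apply_eq_zero x)

theorem IsShortExact.shortExact (h : IsShortExact f g) : h.shortComplex.ShortExact :=
  ModuleCat.shortComplex_shortExact h.shortComplex h.exact h.inj h.surj

theorem IsShortExact.ext_middle (h : IsShortExact f g) (n : ℕ)
    (hA : Subsingleton (ExtMod R A R n)) (hC : Subsingleton (ExtMod R C R n)) :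
    Subsingleton (ExtMod R B R n) := by
  refine subsingleton_of_forall_eq 0 fun x => ?_
  obtain ⟨y, rfl⟩ := Abelian.Ext.contravariant_sequence_exact₂ h.shortExact (ModuleCat.of R R) x
    (Subsingleton.elim (α := ExtMod R A R n) _ _)
  rw [Subsingleton.elim (α := ExtMod R C R n) y 0]
  simp

theorem IsShortExact.ext_left (h : IsShortExact f g) (n : ℕ)
    (hB : Subsingleton (ExtMod R B R n)) (hC : Subsingleton (ExtMod R C R (n + 1))) :
    Subsingleton (ExtMod R A R n) := by
  refine subsingleton_of_forall_eq 0 fun x => ?_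
  obtain ⟨y, rfl⟩ := Abelian.Ext.contravariant_sequence_exact₁ h.shortExact (ModuleCat.of R R) x
    (add_comm 1 n) (Subsingleton.elim (α := ExtMod R C R (n + 1)) _ _)
  rw [Subsingleton.elim (α := ExtMod R B R n) y 0]
  simp

theorem IsShortExact.ext_right (h : IsShortExact f g) (n : ℕ)
    (hA : Subsingleton (ExtMod R A R n)) (hB : Subsingleton (ExtMod R B R (n + 1))) :
    Subsingleton (ExtMod R C R (n + 1)) := by
  refine subsingleton_of_forall_eq 0 fun x => ?_
  obtain ⟨y, rfl⟩ := Abelian.Ext.contravariant_sequence_exact₃ h.shortExact (ModuleCat.of R R) x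
    (Subsingleton.elim (α := ExtMod R B R (n + 1)) _ _) (add_comm 1 n)
  rw [Subsingleton.elim (α := ExtMod R A R n) y 0]
  simp

/-- The connecting homomorphism `Extⁿ(A, R) → Extⁿ⁺¹(C, R)`. -/
def IsShortExact.connecting (h : IsShortExact f g) (n : ℕ) :
    ExtMod R A R n →ₗ[R] ExtMod R C R (n + 1) :=
  Abelian.Ext.precompOfLinear h.shortExact.extClass R (ModuleCat.of R R) (add_comm 1 n)

theorem ext_projective (P : Type u) [AddCommGroup P] [Module R P] [Module.Projective R P] (n : ℕ) :
    Subsingleton (ExtMod R P R (n + 1)) :=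
  have := (IsProjective.iff_projective P).1 ‹Module.Projective R P›
  Abelian.Ext.subsingleton_of_projective _ _ n

/-- Dimension shifting. -/
def IsShortExact.extEquiv (h : IsShortExact f g) [Module.Projective R B] (n : ℕ) :
    ExtMod R A R (n + 1) ≃ₗ[R] ExtMod R C R (n + 2) :=
  LinearEquiv.ofBijective (h.connecting (n + 1)) (by
    have h1 := ext_projective (R := R) B n
    have h2 := ext_projective (R := R) B (n + 1)
    constructor
    · rw [← LinearMap.ker_eq_bot, LinearMap.ker_eq_bot']
      intro x hx
      obtain ⟨y, rfl⟩ := Abelian.Ext.contravariant_sequence_exact₁ h.shortExact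
        (ModuleCat.of R R) x (add_comm 1 (n + 1)) hx
      rw [Subsingleton.elim (α := ExtMod R B R (n + 1)) y 0]
      simp
    · intro x
      exact Abelian.Ext.contravariant_sequence_exact₃ h.shortExact (ModuleCat.of R R) x
        (Subsingleton.elim (α := ExtMod R B R (n + 2)) _ _) (add_comm 1 (n + 1)))

variable (R A) in
/-- `Ext⁰(A, R)` is the dual of `A`. -/
def extZeroEquiv : ExtMod R A R 0 ≃ₗ[R] Module.Dual R A :=
  Abelian.Ext.linearEquiv₀ ≪≫ₗ ModuleCat.homLinearEquiv

/-- The connecting homomorphism `A* → Ext¹(C, R)`. -/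
def IsShortExact.dualConnecting (h : IsShortExact f g) :
    Module.Dual R A →ₗ[R] ExtMod R C R 1 :=
  h.connecting 0 ∘ₗ (extZeroEquiv R A).symm.toLinearMap

theorem extZeroEquiv_symm_dualMap (f : A →ₗ[R] B) (y : Module.Dual R B) :
    (Abelian.Ext.mk₀ (ModuleCat.ofHom f)).comp ((extZeroEquiv R B).symm y) (zero_add 0) =
      (extZeroEquiv R A).symm (f.dualMap y) := by
  simp [extZeroEquiv]
  rfl

theorem IsShortExact.exact_dualConnecting (h : IsShortExact f g) :
    Function.Exact f.dualMap h.dualConnecting := by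
  intro x
  constructor
  · intro hx
    obtain ⟨y, hy⟩ := Abelian.Ext.contravariant_sequence_exact₁ h.shortExact
        (ModuleCat.of R R) ((extZeroEquiv R A).symm x) (add_comm 1 0) hx
    obtain ⟨y, rfl⟩ := (extZeroEquiv R B).symm.surjective y
    refine ⟨y, (extZeroEquiv R A).symm.injective ?_⟩
    rw [← hy]
    exact (extZeroEquiv_symm_dualMap f y).symm
  · rintro ⟨y, rfl⟩
    change h.shortExact.extClass.comp ((extZeroEquiv R A).symm (f.dualMap y)) (add_comm 1 0) = 0
    rw [← extZeroEquiv_symm_dualMap]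
    exact h.shortExact.extClass_comp_assoc _ (h := add_comm 1 0)

theorem IsShortExact.dualConnecting_surjective (h : IsShortExact f g)
    (hB : Subsingleton (ExtMod R B R 1)) : Function.Surjective h.dualConnecting := by
  intro x
  obtain ⟨y, rfl⟩ := Abelian.Ext.contravariant_sequence_exact₃ h.shortExact (ModuleCat.of R R) x
    (Subsingleton.elim (α := ExtMod R B R 1) _ _) (add_comm 1 0)
  exact ⟨extZeroEquiv R A y, by simp [dualConnecting]; rfl⟩

theorem IsShortExact.dual_exact (h : IsShortExact f g) : Function.Exact g.dualMap f.dualMap :=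
  LinearMap.exact_lcomp_of_exact_of_surjective R h.exact h.surj

theorem IsShortExact.dual (h : IsShortExact f g) (hC : Subsingleton (ExtMod R C R 1)) :
    IsShortExact g.dualMap f.dualMap where
  inj := LinearMap.dualMap_injective_of_surjective h.surj
  exact := h.dual_exact
  surj x := (h.exact_dualConnecting x).1 (Subsingleton.elim _ _)

/-- The connecting map onto `Ext¹(C, R)` is surjective by `hB` and zero by `hf`. -/
theorem IsShortExact.ext_one_right (h : IsShortExact f g) (hB : Subsingleton (ExtMod R B R 1))
    (hf : Function.Surjective f.dualMap) : Subsingleton (ExtMod R C R 1) := by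
  refine subsingleton_of_forall_eq 0 fun x => ?_
  obtain ⟨y, rfl⟩ := h.dualConnecting_surjective hB x
  exact (h.exact_dualConnecting y).2 (hf y)

theorem ext_congr (e : A ≃ₗ[R] B) (n : ℕ) (hB : Subsingleton (ExtMod R B R n)) :
    Subsingleton (ExtMod R A R n) := by
  -- An isomorphism is a short exact sequence with zero third term.
  have h : IsShortExact (R := R) (e : A →ₗ[R] B) (0 : B →ₗ[R] PUnit.{u+1}) :=
    ⟨e.injective, fun x => by simp, fun x => ⟨0, rfl⟩⟩
  exact h.ext_left n hB (ext_projective _ _)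

end Ext
end ShortExact

/-! ### Stable isomorphism, fibre products and split sequences. -/

section Stable

variable {R : Type u} [CommRing R]
variable {A B C X Y Z : Type u} [AddCommGroup A] [Module R A] [AddCommGroup B] [Module R B]
    [AddCommGroup C] [Module R C] [AddCommGroup X] [Module R X] [AddCommGroup Y] [Module R Y]
    [AddCommGroup Z] [Module R Z]

theorem StablyIsomorphic.of_equiv_prod (P Q : Type u) [AddCommGroup P] [Module R P]
    [AddCommGroup Q] [Module R Q] [Module.Finite R P] [Module.Projective R P]
    [Module.Finite R Q] [Module.Projective R Q] (e : (X × P) ≃ₗ[R] (Y × Q)) :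
    StablyIsomorphic R X Y :=
  ⟨ModuleCat.of R P, ModuleCat.of R Q, ‹_›, ‹_›, ‹_›, ‹_›, ⟨e⟩⟩

theorem StablyIsomorphic.exists_equiv (h : StablyIsomorphic R X Y) :
    ∃ (P : Type u) (_ : AddCommGroup P) (_ : Module R P) (Q : Type u) (_ : AddCommGroup Q)
      (_ : Module R Q), Module.Finite R P ∧ Module.Projective R P ∧ Module.Finite R Q ∧
      Module.Projective R Q ∧ Nonempty ((X × P) ≃ₗ[R] (Y × Q)) := by
  obtain ⟨P, Q, h1, h2, h3, h4, h5⟩ := h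
  exact ⟨P, _, _, Q, _, _, h1, h2, h3, h4, h5⟩

theorem StablyIsomorphic.of_equiv (e : X ≃ₗ[R] Y) : StablyIsomorphic R X Y :=
  .of_equiv_prod PUnit.{u+1} PUnit.{u+1} (e.prodCongr (.refl R _))

variable (R X) in
theorem StablyIsomorphic.refl : StablyIsomorphic R X X := .of_equiv (.refl R X)

theorem StablyIsomorphic.symm (h : StablyIsomorphic R X Y) : StablyIsomorphic R Y X := by
  obtain ⟨P, Q, h1, h2, h3, h4, ⟨e⟩⟩ := h
  exact ⟨Q, P, h3, h4, h1, h2, ⟨e.symm⟩⟩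

variable (R X Y Z) in
/-- `(X × Y) × Z ≃ (X × Z) × Y`. -/
def prodRightComm : ((X × Y) × Z) ≃ₗ[R] ((X × Z) × Y) :=
  LinearEquiv.prodAssoc R X Y Z ≪≫ₗ (LinearEquiv.refl R X).prodCongr (LinearEquiv.prodComm R Y Z)
    ≪≫ₗ (LinearEquiv.prodAssoc R X Z Y).symm

theorem StablyIsomorphic.trans (h : StablyIsomorphic R X Y) (h' : StablyIsomorphic R Y Z) :
    StablyIsomorphic R X Z := by
  obtain ⟨P, _, _, Q, _, _, _, _, _, _, ⟨e⟩⟩ := h.exists_equiv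
  obtain ⟨P', _, _, Q', _, _, _, _, _, _, ⟨e'⟩⟩ := h'.exists_equiv
  exact .of_equiv_prod (P × P') (Q' × Q)
    ((LinearEquiv.prodAssoc R X P P').symm ≪≫ₗ e.prodCongr (.refl R P') ≪≫ₗ
      prodRightComm R Y Q P' ≪≫ₗ e'.prodCongr (.refl R Q) ≪≫ₗ LinearEquiv.prodAssoc R Z Q' Q)

theorem StablyIsomorphic.finite (h : StablyIsomorphic R X Y) [Module.Finite R X] :
    Module.Finite R Y := by
  obtain ⟨P, _, _, Q, _, _, _, _, _, _, ⟨e⟩⟩ := h.exists_equiv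
  exact Module.Finite.of_surjective (LinearMap.fst R Y Q ∘ₗ e.toLinearMap)
    (Prod.fst_surjective.comp e.surjective)

theorem StablyIsomorphic.dual (h : StablyIsomorphic R X Y) :
    StablyIsomorphic R (Module.Dual R X) (Module.Dual R Y) := by
  obtain ⟨P, _, _, Q, _, _, _, _, _, _, ⟨e⟩⟩ := h.exists_equiv
  exact .of_equiv_prod (Module.Dual R P) (Module.Dual R Q)
    (Module.dualProdDualEquivDual R X P ≪≫ₗ e.symm.dualMap ≪≫ₗ
      (Module.dualProdDualEquivDual R Y Q).symm)

variable (R A B) in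
theorem isShortExact_inl_snd : IsShortExact (LinearMap.inl R A B) (LinearMap.snd R A B) :=
  ⟨LinearMap.inl_injective, .inl_snd, LinearMap.snd_surjective⟩

theorem isShortExact_ker (g : B →ₗ[R] C) (hg : Function.Surjective g) :
    IsShortExact (LinearMap.ker g).subtype g :=
  ⟨Submodule.subtype_injective _, LinearMap.exact_subtype_ker_map g, hg⟩

theorem IsShortExact.nonempty_equiv_prod {f : A →ₗ[R] B} {g : B →ₗ[R] C} (h : IsShortExact f g)
    [Module.Projective R C] : Nonempty (B ≃ₗ[R] A × C) := by
  obtain ⟨s, hs⟩ := Module.projective_lifting_property g LinearMap.id h.surj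
  exact ⟨(h.exact.splitSurjectiveEquiv h.inj ⟨s, hs⟩).1⟩

theorem IsShortExact.stablyIsomorphic {f : A →ₗ[R] B} {g : B →ₗ[R] C} (h : IsShortExact f g)
    [Module.Projective R C] [Module.Finite R C] : StablyIsomorphic R A B := by
  obtain ⟨e⟩ := h.nonempty_equiv_prod
  exact .of_equiv_prod C PUnit.{u+1} (e.symm ≪≫ₗ LinearEquiv.prodUnique.symm)

theorem IsShortExact.equiv_comp {f : A →ₗ[R] B} {g : B →ₗ[R] C} (h : IsShortExact f g)
    (e : C ≃ₗ[R] Z) : IsShortExact f (e.toLinearMap ∘ₗ g) :=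
  ⟨h.inj, fun x => by simpa using h.exact x, e.surjective.comp h.surj⟩

/-- The projection of a fibre product has the same kernel as the opposite map. -/
theorem IsShortExact.pullback {A' B' : Type u} [AddCommGroup A'] [Module R A'] [AddCommGroup B']
    [Module R B'] {f : A →ₗ[R] B} {g : B →ₗ[R] C} {f' : A' →ₗ[R] B'} {g' : B' →ₗ[R] C}
    (h : IsShortExact f g) (h' : IsShortExact f' g') :
    ∃ (E : Type u) (_ : AddCommGroup E) (_ : Module R E) (i' : A' →ₗ[R] E) (p : E →ₗ[R] B)
      (i : A →ₗ[R] E) (p' : E →ₗ[R] B'), IsShortExact i' p ∧ IsShortExact i p' := by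
  let E := LinearMap.ker (g.coprod (-g'))
  have hE : ∀ x : B × B', x ∈ E ↔ g x.1 = g' x.2 := fun x => by
    simp [E, LinearMap.mem_ker, ← sub_eq_add_neg, sub_eq_zero]
  refine ⟨E, inferInstance, inferInstance,
    (LinearMap.inr R B B' ∘ₗ f').codRestrict E
      (fun x => (hE _).2 (by simpa using (h'.exact.apply_apply_eq_zero x).symm)),
    LinearMap.fst R B B' ∘ₗ E.subtype,
    (LinearMap.inl R B B' ∘ₗ f).codRestrict E
      (fun x => (hE _).2 (by simpa using h.exact.apply_apply_eq_zero x)),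
    LinearMap.snd R B B' ∘ₗ E.subtype, ⟨?_, ?_, ?_⟩, ⟨?_, ?_, ?_⟩⟩
  · intro x y hxy
    exact h'.inj (congrArg (fun z : E => z.1.2) hxy)
  · rintro ⟨⟨x, y⟩, hxy⟩
    rw [hE] at hxy
    constructor
    · intro hx
      obtain rfl : x = 0 := hx
      obtain ⟨z, rfl⟩ := (h'.exact y).1 (by simpa using hxy.symm)
      exact ⟨z, rfl⟩
    · rintro ⟨z, hz⟩
      exact (congrArg (fun z : E => z.1.1) hz).symm
  · intro x
    obtain ⟨y, hy⟩ := h'.surj (g x)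
    exact ⟨⟨(x, y), (hE _).2 hy.symm⟩, rfl⟩
  · intro x y hxy
    exact h.inj (congrArg (fun z : E => z.1.1) hxy)
  · rintro ⟨⟨x, y⟩, hxy⟩
    rw [hE] at hxy
    constructor
    · intro hy
      obtain rfl : y = 0 := hy
      obtain ⟨z, rfl⟩ := (h.exact x).1 (by simpa using hxy)
      exact ⟨z, rfl⟩
    · rintro ⟨z, hz⟩
      exact (congrArg (fun z : E => z.1.2) hz).symm
  · intro y
    obtain ⟨x, hx⟩ := h.surj (g' y)
    exact ⟨⟨(x, y), (hE _).2 hx⟩, rfl⟩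

/-- The kernel of a composite of two surjections is an extension of their kernels. -/
theorem IsShortExact.comp {Q E : Type u} [AddCommGroup Q] [Module R Q] [AddCommGroup E]
    [Module R E] {j : A →ₗ[R] Q} {q : Q →ₗ[R] E} {i : B →ₗ[R] E} {p : E →ₗ[R] C}
    (h : IsShortExact j q) (h' : IsShortExact i p) :
    ∃ (K : Type u) (_ : AddCommGroup K) (_ : Module R K) (k : K →ₗ[R] Q) (a : A →ₗ[R] K)
      (b : K →ₗ[R] B), IsShortExact k (p ∘ₗ q) ∧ IsShortExact a b := by
  let K := LinearMap.ker (p ∘ₗ q)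
  let e := LinearEquiv.ofInjective i h'.inj
  let b₀ : K →ₗ[R] LinearMap.range i :=
    (q ∘ₗ K.subtype).codRestrict _ (fun x => (h'.exact _).1 x.2)
  have hb : ∀ x, i (e.symm (b₀ x)) = q x := fun x => by
    have := congrArg Subtype.val (e.apply_symm_apply (b₀ x))
    exact this
  have hc := isShortExact_ker (p ∘ₗ q) (h'.surj.comp h.surj)
  refine ⟨K, inferInstance, inferInstance, K.subtype,
    j.codRestrict K (fun x => by simp [K, h.exact.apply_apply_eq_zero]),
    e.symm.toLinearMap ∘ₗ b₀, hc, ⟨?_, ?_, ?_⟩⟩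
  · intro x y hxy
    exact h.inj (congrArg Subtype.val hxy)
  · intro x
    change e.symm (b₀ x) = 0 ↔ _
    rw [← map_eq_zero_iff i h'.inj, hb, h.exact x]
    exact ⟨fun ⟨y, hy⟩ => ⟨y, Subtype.ext hy⟩, fun ⟨y, hy⟩ => ⟨y, congrArg Subtype.val hy⟩⟩
  · intro y
    obtain ⟨x, hx⟩ := h.surj (i y)
    refine ⟨⟨x, by simp [K, hx, h'.exact.apply_apply_eq_zero]⟩, h'.inj ?_⟩
    exact (hb _).trans hx

/-- The kernel is unchanged, so projective summands of the target can be absorbed into the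
projective cover or presentation. -/
theorem IsShortExact.prodMap_id (Q : Type u) [AddCommGroup Q] [Module R Q] {f : A →ₗ[R] B}
    {g : B →ₗ[R] C} (h : IsShortExact f g) :
    IsShortExact (LinearMap.inl R B Q ∘ₗ f) (g.prodMap (LinearMap.id : Q →ₗ[R] Q)) := by
  refine ⟨LinearMap.inl_injective.comp h.inj, ?_, ?_⟩
  · rintro ⟨x, y⟩
    constructor
    · intro hx
      obtain ⟨h1, rfl⟩ : g x = 0 ∧ y = 0 := by simpa using hx
      obtain ⟨z, rfl⟩ := (h.exact x).1 h1
      exact ⟨z, rfl⟩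
    · rintro ⟨z, hz⟩
      simp only [LinearMap.comp_apply, LinearMap.inl_apply, Prod.mk.injEq] at hz
      obtain ⟨rfl, rfl⟩ := hz
      simp [h.exact.apply_apply_eq_zero]
  · exact Function.Surjective.prodMap h.surj Function.surjective_id

end Stable

/-! ### Syzygies up to projective summands: Schanuel and horseshoe. -/

section Syzygies

variable (R : Type u) [CommRing R]

/-- `X` is the kernel of a surjection from a finitely generated projective module onto `Y`. -/
def IsSyz (X Y : Type u) [AddCommGroup X] [Module R X] [AddCommGroup Y] [Module R Y] : Prop :=
  ∃ (P : Type u) (_ : AddCommGroup P) (_ : Module R P) (f : X →ₗ[R] P) (g : P →ₗ[R] Y),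
    Module.Finite R P ∧ Module.Projective R P ∧ IsShortExact f g

/-- `X` is stably isomorphic to an `n`-th syzygy of `Y`. -/
def IsSyzN (X : Type u) [AddCommGroup X] [Module R X] :
    ℕ → (Y : Type u) → [AddCommGroup Y] → [Module R Y] → Prop
  | 0, Y, _, _ => StablyIsomorphic R X Y
  | n + 1, Y, _, _ => ∃ (K : Type u) (_ : AddCommGroup K) (_ : Module R K),
      IsSyz R K Y ∧ IsSyzN X n K

/-- `Y` has projective dimension less than `n`. -/
def ProjDimLT : ℕ → (Y : Type u) → [AddCommGroup Y] → [Module R Y] → Prop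
  | 0, Y, _, _ => Subsingleton Y
  | n + 1, Y, _, _ => ∃ (K : Type u) (_ : AddCommGroup K) (_ : Module R K),
      IsSyz R K Y ∧ ProjDimLT n K

variable {R}
variable {A B C X Y Z X' Y' : Type u} [AddCommGroup A] [Module R A] [AddCommGroup B] [Module R B]
    [AddCommGroup C] [Module R C] [AddCommGroup X] [Module R X] [AddCommGroup Y] [Module R Y]
    [AddCommGroup Z] [Module R Z] [AddCommGroup X'] [Module R X'] [AddCommGroup Y'] [Module R Y']

variable (R Y) in
theorem exists_isSyz [Module.Finite R Y] :
    ∃ (X : Type u) (_ : AddCommGroup X) (_ : Module R X), IsSyz R X Y := by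
  obtain ⟨n, g, hg⟩ := Module.Finite.exists_fin' R Y
  exact ⟨_, _, _, Fin n → R, _, _, _, g, inferInstance, inferInstance, isShortExact_ker g hg⟩

theorem IsSyz.finite_right (h : IsSyz R X Y) : Module.Finite R Y := by
  obtain ⟨P, _, _, f, g, _, _, h⟩ := h
  exact Module.Finite.of_surjective g h.surj

theorem IsSyz.of_equiv_right (h : IsSyz R X Y) (e : Y ≃ₗ[R] Z) : IsSyz R X Z := by
  obtain ⟨P, _, _, f, g, h1, h2, h⟩ := h
  exact ⟨P, _, _, f, _, h1, h2, h.equiv_comp e⟩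

theorem IsSyz.prod_projective (Q : Type u) [AddCommGroup Q] [Module R Q] [Module.Finite R Q]
    [Module.Projective R Q] (h : IsSyz R X Y) : IsSyz R X (Y × Q) := by
  obtain ⟨P, _, _, f, g, h1, h2, h⟩ := h
  exact ⟨P × Q, _, _, _, _, inferInstance, inferInstance, h.prodMap_id Q⟩

/-- Schanuel's lemma. -/
theorem IsSyz.stablyIsomorphic (h : IsSyz R X Y) (h' : IsSyz R X' Y)  :
    StablyIsomorphic R X X' := by
  obtain ⟨P, _, _, f, g, h1, h2, h⟩ := h
  obtain ⟨P', _, _, f', g', h1', h2', h'⟩ := h'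
  obtain ⟨E, _, _, _, _, _, _, hE, hE'⟩ := h.pullback h'
  exact hE'.stablyIsomorphic.trans hE.stablyIsomorphic.symm

theorem IsSyz.stablyIsomorphic_of (h : IsSyz R X Y) (h' : IsSyz R X' Y')
    (hY : StablyIsomorphic R Y Y') : StablyIsomorphic R X X' := by
  obtain ⟨P, _, _, Q, _, _, _, _, _, _, ⟨e⟩⟩ := hY.exists_equiv
  exact ((h.prod_projective P).of_equiv_right e).stablyIsomorphic (h'.prod_projective Q)

theorem IsSyz.exists_of_stablyIsomorphic (h : IsSyz R X Y) (hY : StablyIsomorphic R Y Y') :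
    ∃ (X' : Type u) (_ : AddCommGroup X') (_ : Module R X'), IsSyz R X' Y' ∧
      StablyIsomorphic R X X' := by
  have := h.finite_right
  have := hY.finite
  obtain ⟨X', _, _, h'⟩ := exists_isSyz R Y'
  exact ⟨X', _, _, h', h.stablyIsomorphic_of h' hY⟩

theorem IsSyzN.stablyIsomorphic {n : ℕ} (h : IsSyzN R X n Y) (h' : IsSyzN R X' n Y')
    (hY : StablyIsomorphic R Y Y') : StablyIsomorphic R X X' := by
  induction n generalizing Y Y' with
  | zero => exact (StablyIsomorphic.trans h hY).trans (StablyIsomorphic.symm h')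
  | succ n ih =>
    obtain ⟨K, _, _, hK, h⟩ := h
    obtain ⟨K', _, _, hK', h'⟩ := h'
    exact ih h h' (hK.stablyIsomorphic_of hK' hY)

theorem IsSyzN.congr_right {n : ℕ} (h : IsSyzN R X n Y) (hY : StablyIsomorphic R Y Y') :
    IsSyzN R X n Y' := by
  induction n generalizing Y Y' with
  | zero => exact StablyIsomorphic.trans h hY
  | succ n ih =>
    obtain ⟨K, _, _, hK, h⟩ := h
    obtain ⟨K', _, _, hK', h'⟩ := hK.exists_of_stablyIsomorphic hY
    exact ⟨K', _, _, hK', ih h h'⟩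

theorem IsSyzN.congr_left {n : ℕ} (h : IsSyzN R X n Y) (hX : StablyIsomorphic R X' X) :
    IsSyzN R X' n Y := by
  induction n generalizing Y with
  | zero => exact hX.trans h
  | succ n ih =>
    obtain ⟨K, _, _, hK, h⟩ := h
    exact ⟨K, _, _, hK, ih h⟩

theorem IsSyzN.trans {m n : ℕ} (h : IsSyzN R X m Y) (h' : IsSyzN R Y n Z) :
    IsSyzN R X (m + n) Z := by
  induction n generalizing Z with
  | zero => exact h.congr_right h'
  | succ n ih =>
    obtain ⟨K, _, _, hK, h'⟩ := h'
    exact ⟨K, _, _, hK, ih h'⟩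

theorem IsSyz.isSyzN (h : IsSyz R X Y) : IsSyzN R X 1 Y :=
  ⟨X, _, _, h, .refl R X⟩

theorem isSyzN_of_chain (T : ℕ → Type u) [∀ k, AddCommGroup (T k)] [∀ k, Module R (T k)]
    (hT : ∀ k, IsSyz R (T (k + 1)) (T k)) (m n : ℕ) : IsSyzN R (T (m + n)) n (T m) := by
  induction n with
  | zero => exact StablyIsomorphic.refl R (T m)
  | succ n ih =>
    have := (hT (m + n)).isSyzN.trans ih
    rwa [add_comm 1 n] at this

/-- The horseshoe lemma. -/
theorem IsShortExact.horseshoe {f : A →ₗ[R] B} {g : B →ₗ[R] C} (h : IsShortExact f g)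
    (hA : IsSyz R X A) (hC : IsSyz R Z C) :
    ∃ (Y : Type u) (_ : AddCommGroup Y) (_ : Module R Y) (f' : X →ₗ[R] Y) (g' : Y →ₗ[R] Z),
      IsSyz R Y B ∧ IsShortExact f' g' := by
  obtain ⟨P, _, _, f₁, g₁, _, _, h₁⟩ := hA
  obtain ⟨Q, _, _, f₂, g₂, _, _, h₂⟩ := hC
  obtain ⟨E, _, _, _, _, _, _, hE, hE'⟩ := h.pullback h₂
  obtain ⟨e⟩ := hE'.nonempty_equiv_prod
  obtain ⟨K, _, _, k, a, b, hK, hab⟩ := ((h₁.prodMap_id Q).equiv_comp e.symm).comp hE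
  exact ⟨K, _, _, a, b, ⟨P × Q, _, _, k, _, inferInstance, inferInstance, hK⟩, hab⟩

/-- By the horseshoe lemma, syzygies can be taken of the whole sequence at once; after `n` steps the
left term is zero and the other two coincide. -/
theorem ProjDimLT.isSyzN {n : ℕ} {f : A →ₗ[R] B} {g : B →ₗ[R] C} (hA : ProjDimLT R n A)
    (h : IsShortExact f g) (hX : IsSyzN R X n C) : IsSyzN R X n B := by
  induction n generalizing A B C with
  | zero =>
    have : Subsingleton A := hA
    have hg : Function.Injective g := by
      rw [← LinearMap.ker_eq_bot, LinearMap.ker_eq_bot']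
      intro x hx
      obtain ⟨y, rfl⟩ := (h.exact x).1 hx
      rw [Subsingleton.elim y 0, map_zero]
    exact StablyIsomorphic.trans hX
      (.of_equiv (LinearEquiv.ofBijective g ⟨hg, h.surj⟩).symm)
  | succ n ih =>
    obtain ⟨A', _, _, hA', hA⟩ := hA
    obtain ⟨C', _, _, hC', hX⟩ := hX
    obtain ⟨B', _, _, f', g', hB', h'⟩ := h.horseshoe hA' hC'
    exact ⟨B', _, _, hB', ih hA h' hX⟩

end Syzygies

/-! ### Totally reflexive modules and duality of syzygies. -/

section TotallyReflexive

variable {R : Type u} [CommRing R]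
variable {A B C X Y Z X' Y' : Type u} [AddCommGroup A] [Module R A] [AddCommGroup B] [Module R B]
    [AddCommGroup C] [Module R C] [AddCommGroup X] [Module R X] [AddCommGroup Y] [Module R Y]
    [AddCommGroup Z] [Module R Z] [AddCommGroup X'] [Module R X'] [AddCommGroup Y'] [Module R Y']

theorem IsTotallyReflexive.isReflexive (h : IsTotallyReflexive R X) : Module.IsReflexive R X :=
  ⟨h.reflexive⟩

variable (R X) in
theorem isTotallyReflexive_of_projective [Module.Finite R X] [Module.Projective R X] :
    IsTotallyReflexive R X where
  finite := ‹_›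
  reflexive := Module.bijective_dual_eval R X
  ext_eq_zero i hi := by
    obtain ⟨n, rfl⟩ := Nat.exists_eq_succ_of_ne_zero hi.ne'
    exact ext_projective X n
  ext_dual_eq_zero i hi := by
    obtain ⟨n, rfl⟩ := Nat.exists_eq_succ_of_ne_zero hi.ne'
    exact ext_projective (Module.Dual R X) n

/-- The bidual sequence is again exact, so reflexivity of `B` and `C` passes to `A` by a diagram
chase. -/
theorem IsTotallyReflexive.ker [IsNoetherianRing R] {f : A →ₗ[R] B} {g : B →ₗ[R] C}
    (h : IsShortExact f g) (hB : IsTotallyReflexive R B) (hC : IsTotallyReflexive R C) :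
    IsTotallyReflexive R A := by
  have hD := h.dual (hC.ext_eq_zero 1 one_pos)
  have hg : ∀ x, g.dualMap.dualMap (Module.Dual.eval R B x) = Module.Dual.eval R C (g x) :=
    fun x => rfl
  have hf : ∀ x, f.dualMap.dualMap (Module.Dual.eval R A x) = Module.Dual.eval R B (f x) :=
    fun x => rfl
  -- Since `g` and evaluation on `C` are onto, so is the bidual of `g`; this forces `Ext¹(A*, R) =
  -- 0`, the one degree that the long exact sequence alone does not give.
  have hgs : Function.Surjective g.dualMap.dualMap := by
    intro y
    obtain ⟨z, rfl⟩ := hC.reflexive.2 y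
    obtain ⟨x, rfl⟩ := h.surj z
    exact ⟨_, hg x⟩
  have hA1 := hD.ext_one_right (hB.ext_dual_eq_zero 1 one_pos) hgs
  have hDD := hD.dual hA1
  have := hB.finite
  refine ⟨Module.Finite.of_injective f h.inj, ⟨?_, ?_⟩, ?_, ?_⟩
  · refine Function.Injective.of_comp (f := f.dualMap.dualMap) ?_
    exact hB.reflexive.1.comp h.inj
  · intro y
    obtain ⟨b, hb⟩ := hB.reflexive.2 (f.dualMap.dualMap y)
    have : g b = 0 := hC.reflexive.1 (by
      rw [← hg, hb, hDD.exact.apply_apply_eq_zero, map_zero])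
    obtain ⟨a, rfl⟩ := (h.exact b).1 this
    exact ⟨a, hDD.inj (by rw [hf, hb])⟩
  · intro i hi
    exact h.ext_left i (hB.ext_eq_zero i hi) (hC.ext_eq_zero (i + 1) i.succ_pos)
  · intro i hi
    obtain _ | _ | i := i
    · exact absurd hi (lt_irrefl 0)
    · exact hA1
    · exact hD.ext_right (i + 1) (hC.ext_dual_eq_zero _ i.succ_pos)
        (hB.ext_dual_eq_zero _ (Nat.succ_pos _))

theorem IsTotallyReflexive.dual [IsNoetherianRing R] (h : IsTotallyReflexive R X) :
    IsTotallyReflexive R (Module.Dual R X) := by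
  have := h.finite
  have := h.isReflexive
  exact ⟨inferInstance, Module.bijective_dual_eval R _, h.ext_dual_eq_zero, fun i hi =>
    ext_congr (Module.evalEquiv R X).symm i (h.ext_eq_zero i hi)⟩

theorem IsTotallyReflexive.of_equiv (h : IsTotallyReflexive R X) (e : X ≃ₗ[R] Y) :
    IsTotallyReflexive R Y := by
  have := h.finite
  have := h.isReflexive
  have := Module.equiv e
  exact ⟨.equiv e, Module.bijective_dual_eval R _,
    fun i hi => ext_congr e.symm i (h.ext_eq_zero i hi),
    fun i hi => ext_congr e.dualMap i (h.ext_dual_eq_zero i hi)⟩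

theorem IsTotallyReflexive.prod_projective (h : IsTotallyReflexive R X) (P : Type u)
    [AddCommGroup P] [Module R P] [Module.Finite R P] [Module.Projective R P] :
    IsTotallyReflexive R (X × P) := by
  have := h.finite
  have := h.isReflexive
  have hP := isTotallyReflexive_of_projective R P
  have hD := (isShortExact_inl_snd R X P).dual (hP.ext_eq_zero 1 one_pos)
  exact ⟨inferInstance, Module.bijective_dual_eval R _,
    fun i hi => (isShortExact_inl_snd R X P).ext_middle i (h.ext_eq_zero i hi)
      (hP.ext_eq_zero i hi),
    fun i hi => hD.ext_middle i (hP.ext_dual_eq_zero i hi) (h.ext_dual_eq_zero i hi)⟩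

theorem IsTotallyReflexive.of_stablyIsomorphic [IsNoetherianRing R] (h : IsTotallyReflexive R X)
    (hXY : StablyIsomorphic R X Y) : IsTotallyReflexive R Y := by
  obtain ⟨P, _, _, Q, _, _, _, _, _, _, ⟨e⟩⟩ := hXY.exists_equiv
  -- `Y` is the kernel of the projection from `Y × Q` onto `Q`.
  exact .ker (isShortExact_inl_snd R Y Q) ((h.prod_projective P).of_equiv e)
    (isTotallyReflexive_of_projective R Q)

theorem IsSyz.isTotallyReflexive [IsNoetherianRing R] (h : IsSyz R X Y)
    (hY : IsTotallyReflexive R Y) : IsTotallyReflexive R X := by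
  obtain ⟨P, _, _, f, g, _, _, h⟩ := h
  exact .ker h (isTotallyReflexive_of_projective R P) hY

/-- Vanishing of `Ext¹(Y, R)` keeps the dualized presentation exact, and dualizing swaps kernel and
quotient. -/
theorem IsSyz.dual (h : IsSyz R X Y) (hY : IsTotallyReflexive R Y) :
    IsSyz R (Module.Dual R Y) (Module.Dual R X) := by
  obtain ⟨P, _, _, f, g, _, _, h⟩ := h
  exact ⟨Module.Dual R P, _, _, _, _, inferInstance, inferInstance,
    h.dual (hY.ext_eq_zero 1 one_pos)⟩

theorem IsSyzN.isTotallyReflexive [IsNoetherianRing R] {n : ℕ} (h : IsSyzN R X n Y)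
    (hY : IsTotallyReflexive R Y) : IsTotallyReflexive R X := by
  induction n generalizing Y with
  | zero => exact hY.of_stablyIsomorphic (StablyIsomorphic.symm h)
  | succ n ih =>
    obtain ⟨K, _, _, hK, h⟩ := h
    exact ih h (hK.isTotallyReflexive hY)

theorem IsSyzN.dual [IsNoetherianRing R] {n : ℕ} (h : IsSyzN R X n Y)
    (hY : IsTotallyReflexive R Y) : IsSyzN R (Module.Dual R Y) n (Module.Dual R X) := by
  induction n generalizing Y with
  | zero => exact StablyIsomorphic.dual (StablyIsomorphic.symm h)
  | succ n ih =>
    obtain ⟨K, _, _, hK, h⟩ := h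
    have := (hK.dual hY).isSyzN.trans (ih h (hK.isTotallyReflexive hY))
    rwa [add_comm 1 n] at this

/-- Totally reflexive modules are stably determined by their syzygies. -/
theorem IsSyzN.stablyIsomorphic_right [IsNoetherianRing R] {n : ℕ} (h : IsSyzN R X n Y)
    (h' : IsSyzN R X' n Y') (hY : IsTotallyReflexive R Y) (hY' : IsTotallyReflexive R Y')
    (hX : StablyIsomorphic R X X') : StablyIsomorphic R Y Y' := by
  -- The duals of `Y` and `Y'` are `n`-th syzygies of the duals of `X` and `X'`, hence stably
  -- isomorphic; dualizing again recovers `Y` and `Y'`.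
  have := ((h.dual hY).stablyIsomorphic (h'.dual hY') hX.dual).dual
  have := hY.isReflexive
  have := hY'.isReflexive
  exact (StablyIsomorphic.of_equiv (Module.evalEquiv R Y)).trans
    (StablyIsomorphic.trans ‹_› (.of_equiv (Module.evalEquiv R Y').symm))

end TotallyReflexive

/-! ### Gorenstein dimension and syzygies. -/

section GorensteinDimension

variable (R : Type u) [CommRing R]

/-- `Y` has Gorenstein dimension at most `n`. -/
def GdimLE : ℕ → (Y : Type u) → [AddCommGroup Y] → [Module R Y] → Prop
  | 0, Y, _, _ => IsTotallyReflexive R Y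
  | n + 1, Y, _, _ => ∃ (K : Type u) (_ : AddCommGroup K) (_ : Module R K) (G : Type u)
      (_ : AddCommGroup G) (_ : Module R G) (f : K →ₗ[R] G) (g : G →ₗ[R] Y),
      IsTotallyReflexive R G ∧ IsShortExact f g ∧ GdimLE n K

variable {R}
variable {X Y M : Type u} [AddCommGroup X] [Module R X] [AddCommGroup Y] [Module R Y]
  [AddCommGroup M] [Module R M]

theorem GdimLE.finite {n : ℕ} (h : GdimLE R n Y) : Module.Finite R Y := by
  cases n with
  | zero => exact IsTotallyReflexive.finite h
  | succ n =>
    obtain ⟨K, _, _, G, _, _, f, g, hG, h, _⟩ := h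
    have := hG.finite
    exact Module.Finite.of_surjective g h.surj

theorem HasTotallyReflexiveResolution.gdimLE {n : ℕ} (h : HasTotallyReflexiveResolution R M n) :
    GdimLE R n M := by
  induction n generalizing M with
  | zero =>
    obtain ⟨G, d, ε, hG, hG0, hε, hd, -⟩ := h
    have := hG0 1 one_pos
    have hi : Function.Injective ε := by
      rw [← LinearMap.ker_eq_bot, LinearMap.ker_eq_bot']
      intro x hx
      obtain ⟨y, rfl⟩ := (hd x).1 hx
      rw [Subsingleton.elim y 0, map_zero]
    exact (hG 0 le_rfl).of_equiv (LinearEquiv.ofBijective ε ⟨hi, hε⟩)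
  | succ n ih =>
    obtain ⟨G, d, ε, hG, hG0, hε, hd, hd'⟩ := h
    have hK : ∀ x, d 0 x ∈ LinearMap.ker ε := fun x => hd.apply_apply_eq_zero x
    refine ⟨LinearMap.ker ε, _, _, G 0, _, _, _, ε, hG 0 (Nat.zero_le _),
      isShortExact_ker ε hε, ih ⟨fun k => G (k + 1), fun k => d (k + 1),
        (d 0).codRestrict _ hK, fun k hk => hG _ (by lia), fun k hk => hG0 _ (by lia), ?_, ?_,
        fun k => hd' (k + 1)⟩⟩
    · rintro ⟨x, hx⟩
      obtain ⟨y, rfl⟩ := (hd x).1 hx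
      exact ⟨y, rfl⟩
    · intro x
      rw [← hd' 0 x]
      exact Subtype.ext_iff

theorem GdimLE.isSyz [IsNoetherianRing R] {n : ℕ} (h : GdimLE R (n + 1) M) (hX : IsSyz R X M) :
    GdimLE R n X := by
  induction n generalizing M X with
  | zero =>
    obtain ⟨K, _, _, G, _, _, f, g, hG, h, hK⟩ := h
    obtain ⟨P, _, _, f', g', _, _, h'⟩ := hX
    -- `E` is an extension of the projective `P` by `K`, so it is totally reflexive; `X` is the
    -- kernel of `E → G`.
    obtain ⟨E, _, _, i', p, i, p', hE, hE'⟩ := h.pullback h'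
    have hK : IsTotallyReflexive R K := hK
    exact .ker hE (hK.of_stablyIsomorphic hE'.stablyIsomorphic) hG
  | succ n ih =>
    obtain ⟨K, _, _, G, _, _, f, g, hG, h, hK⟩ := h
    have := GdimLE.finite hK
    obtain ⟨K', _, _, hK'⟩ := exists_isSyz R K
    obtain ⟨G', _, _, f', g', hG', h'⟩ := h.horseshoe hK' hX
    exact ⟨K', _, _, G', _, _, f', g', hG'.isTotallyReflexive hG, h', ih hK hK'⟩

theorem GdimLE.isTotallyReflexive [IsNoetherianRing R] {n : ℕ} (h : GdimLE R n M)
    (hX : IsSyzN R X n M) : IsTotallyReflexive R X := by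
  induction n generalizing M with
  | zero => exact IsTotallyReflexive.of_stablyIsomorphic h (StablyIsomorphic.symm hX)
  | succ n ih =>
    obtain ⟨K, _, _, hK, hX⟩ := hX
    exact ih (h.isSyz hK) hX

/-- A finite infimum in `ℕ∞` is attained: otherwise every resolution would have length at least `n +
1`. -/
theorem gdimLE_of_gdim_eq {n : ℕ} (h : Gdim R M = n) : GdimLE R n M := by
  by_contra hn
  have : ((n : ℕ∞) + 1) ≤ Gdim R M := by
    refine le_iInf₂ fun m hm => ?_
    by_contra! hlt
    have hmn : m ≤ n := by
      have : (m : ℕ∞) < (n + 1 : ℕ) := by simpa using hlt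
      exact Nat.lt_succ_iff.1 (by exact_mod_cast this)
    have hne : m ≠ n := fun e => hn (e ▸ hm.gdimLE)
    have : Gdim R M ≤ m := iInf₂_le m hm
    rw [h] at this
    have : n ≤ m := by exact_mod_cast this
    omega
  rw [h] at this
  have : n + 1 ≤ n := by exact_mod_cast this
  omega

end GorensteinDimension

/-! ### Grade, and `Extᵍ` as a quotient of the dual of a syzygy. -/

section Grade

variable {R : Type u} [CommRing R]
variable {A B C : Type u} [AddCommGroup A] [Module R A] [AddCommGroup B] [Module R B]
    [AddCommGroup C] [Module R C]

theorem subsingleton_ext_of_lt_grade {n : ℕ} (h : (n : ℕ∞) < grade R A) :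
    Subsingleton (ExtMod R A R n) := by
  by_contra hn
  rw [not_subsingleton_iff_nontrivial] at hn
  exact (iInf₂_le n hn : grade R A ≤ n).not_gt h

/-- `Ext` is invariant under isomorphisms in the first variable. -/
def extCongr (e : A ≃ₗ[R] B) (n : ℕ) : ExtMod R A R n ≃ₗ[R] ExtMod R B R n :=
  LinearEquiv.ofLinearMap
    (Abelian.Ext.precompOfLinear (Abelian.Ext.mk₀ (ModuleCat.ofHom e.symm.toLinearMap)) R
      (ModuleCat.of R R) (zero_add n))
    (Abelian.Ext.precompOfLinear (Abelian.Ext.mk₀ (ModuleCat.ofHom e.toLinearMap)) R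
      (ModuleCat.of R R) (zero_add n))
    (by
      ext x
      simp [← ModuleCat.ofHom_comp])
    (by
      ext x
      simp [← ModuleCat.ofHom_comp])

theorem IsSyz.nonempty_extEquiv (h : IsSyz R A B) (n : ℕ) :
    Nonempty (ExtMod R A R (n + 1) ≃ₗ[R] ExtMod R B R (n + 2)) := by
  obtain ⟨P, _, _, f, g, _, _, h⟩ := h
  exact ⟨h.extEquiv n⟩

variable (T : ℕ → Type u) [∀ k, AddCommGroup (T k)] [∀ k, Module R (T k)]
theorem nonempty_ext_one_equiv (hT : ∀ k, IsSyz R (T (k + 1)) (T k)) (k : ℕ) :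
    Nonempty (ExtMod R (T k) R 1 ≃ₗ[R] ExtMod R (T 0) R (k + 1)) := by
  -- The extra degree `n` lets the induction trade one syzygy for one degree of Ext.
  suffices ∀ n, Nonempty (ExtMod R (T k) R (n + 1) ≃ₗ[R] ExtMod R (T 0) R (k + n + 1)) from this 0
  induction k with
  | zero => intro n; rw [zero_add]; exact ⟨.refl R _⟩
  | succ k ih =>
    intro n
    obtain ⟨e⟩ := ih (n + 1)
    obtain ⟨e'⟩ := (hT k).nonempty_extEquiv n
    rw [add_right_comm k 1 n]
    exact ⟨e' ≪≫ₗ e⟩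

/-- Below the grade the dualized resolution stays exact, so it resolves the dual of `T k` by `k`
projectives, starting from the zero dual of `T 0`. -/
theorem projDimLT_dual (hT : ∀ k, IsSyz R (T (k + 1)) (T k)) {g k : ℕ}
    (hg : ∀ i < g, Subsingleton (ExtMod R (T 0) R i)) (hk : k < g) :
    ProjDimLT R k (Module.Dual R (T k)) := by
  induction k with
  | zero =>
    have := hg 0 hk
    exact (extZeroEquiv R (T 0)).symm.injective.subsingleton
  | succ k ih =>
    refine ⟨Module.Dual R (T k), _, _, ?_, ih (by lia)⟩
    obtain ⟨e⟩ := nonempty_ext_one_equiv T hT k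
    have := hg _ hk
    obtain ⟨P, _, _, f, g, _, _, h⟩ := hT k
    exact ⟨Module.Dual R P, _, _, _, _, inferInstance, inferInstance,
      h.dual e.injective.subsingleton⟩

/-- If `Extⁱ(T₀, R) = 0` for `i < g` then `Extᵍ(T₀, R)` is the quotient of the dual of the `g`-th
syzygy by a module of finite projective dimension. -/
theorem exists_isShortExact_ext (hT : ∀ k, IsSyz R (T (k + 1)) (T k)) {g : ℕ}
    (hg : ∀ i < g, Subsingleton (ExtMod R (T 0) R i)) :
    ∃ (B : Type u) (_ : AddCommGroup B) (_ : Module R B) (i : B →ₗ[R] Module.Dual R (T g))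
      (p : Module.Dual R (T g) →ₗ[R] ExtMod R (T 0) R g), ProjDimLT R g B ∧ IsShortExact i p := by
  cases g with
  | zero =>
    refine ⟨PUnit.{u+1}, _, _, 0, (extZeroEquiv R (T 0)).symm.toLinearMap,
      inferInstanceAs (Subsingleton PUnit.{u+1}),
      fun _ _ _ => rfl, fun x => ?_, (extZeroEquiv R (T 0)).symm.surjective⟩
    rw [LinearEquiv.coe_coe, LinearEquiv.map_eq_zero_iff]
    exact ⟨fun h => ⟨0, h.symm⟩, fun ⟨_, h⟩ => h.symm⟩
  | succ k =>
    have hk := projDimLT_dual T hT hg (Nat.lt_succ_self k)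
    obtain ⟨e⟩ := nonempty_ext_one_equiv T hT k
    obtain ⟨P, _, _, f, g, _, _, h⟩ := hT k
    have hp := h.dualConnecting_surjective (ext_projective P 0)
    -- The submodule is the image of `P*`; the kernel of `P*` onto it is the dual of `T k`, and the
    -- quotient by it is `Ext¹(T k, R) ≅ Extᵏ⁺¹(T 0, R)`.
    refine ⟨LinearMap.range f.dualMap, _, _, (LinearMap.range f.dualMap).subtype,
      e.toLinearMap ∘ₗ h.dualConnecting,
      ⟨Module.Dual R (T k), _, _, ⟨Module.Dual R P, _, _, g.dualMap, f.dualMap.rangeRestrict,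
        inferInstance, inferInstance, ?_⟩, hk⟩,
      ⟨Submodule.subtype_injective _, fun x => ?_, e.surjective.comp hp⟩⟩
    · exact ⟨LinearMap.dualMap_injective_of_surjective h.surj,
        fun x => by rw [← h.dual_exact x]; exact Subtype.ext_iff, f.dualMap.surjective_rangeRestrict⟩
    · rw [LinearMap.comp_apply, LinearEquiv.coe_coe, LinearEquiv.map_eq_zero_iff,
        h.exact_dualConnecting x]
      simp

end Grade

/-! ### Projective resolutions and their syzygies. -/

section Resolution

variable {R : Type u} [CommRing R] {M : ModuleCat.{u} R} (F : ProjectiveResolution M)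

theorem exact_d (n : ℕ) : Function.Exact (F.complex.d (n + 2) (n + 1)).hom
    (F.complex.d (n + 1) n).hom :=
  (ShortComplex.ShortExact.moduleCat_exact_iff_function_exact _).1 (F.exact_succ n)

/-- The augmentation of a projective resolution. -/
def augmentation : F.complex.X 0 →ₗ[R] M := (F.π.f 0 : F.complex.X 0 ⟶ M).hom

theorem exact_augmentation : Function.Exact (F.complex.d 1 0).hom (augmentation F) :=
  (ShortComplex.ShortExact.moduleCat_exact_iff_function_exact _).1 F.exact₀

theorem augmentation_surjective : Function.Surjective (augmentation F) :=
  (ModuleCat.epi_iff_surjective (F.π.f 0)).1 inferInstance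

/-- The zeroth syzygy. -/
def syzygyZeroEquiv : Syzygy F 0 ≃ₗ[R] M :=
  Submodule.quotEquivOfEq _ _ (LinearMap.exact_iff.1 (exact_augmentation F)).symm ≪≫ₗ
    (augmentation F).quotKerEquivOfSurjective (augmentation_surjective F)

/-- The inclusion of a syzygy. -/
def syzygyInclusion (n : ℕ) : Syzygy F (n + 1) →ₗ[R] F.complex.X n :=
  (LinearMap.range (F.complex.d (n + 2) (n + 1)).hom).liftQ (F.complex.d (n + 1) n).hom
    (LinearMap.exact_iff.1 (exact_d F n)).ge

theorem range_syzygyInclusion (n : ℕ) :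
    LinearMap.range (syzygyInclusion F n) = LinearMap.range (F.complex.d (n + 1) n).hom :=
  Submodule.range_liftQ _ _ _

theorem isShortExact_syzygy (n : ℕ) :
    IsShortExact (syzygyInclusion F n)
      (LinearMap.range (F.complex.d (n + 1) n).hom).mkQ where
  inj := by
    rw [← LinearMap.ker_eq_bot]
    exact Submodule.ker_liftQ_eq_bot _ _ _ (LinearMap.exact_iff.1 (exact_d F n)).le
  exact := by
    rw [LinearMap.exact_iff, range_syzygyInclusion, Submodule.ker_mkQ]
  surj := Submodule.mkQ_surjective _

theorem module_projective (n : ℕ) : Module.Projective R (F.complex.X n) :=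
  have := F.projective n
  ModuleCat.projective_of_module_projective _

theorem isSyz_syzygy (hF : ∀ n, Module.Finite R (F.complex.X n)) (n : ℕ) :
    IsSyz R (Syzygy F (n + 1)) (Syzygy F n) :=
  ⟨F.complex.X n, _, _, _, _, hF n, module_projective F n, isShortExact_syzygy F n⟩

/-- An augmented exact complex of projective modules is a projective resolution. -/
def resolutionOfExact (C : ChainComplex (ModuleCat.{u} R) ℕ)
    (hC : ∀ n, Module.Projective R (C.X n))
    (hd : ∀ n, Function.Exact (C.d (n + 2) (n + 1)).hom (C.d (n + 1) n).hom)
    (ε : C.X 0 →ₗ[R] M) (hε : Function.Exact (C.d 1 0).hom ε) (hs : Function.Surjective ε) :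
    ProjectiveResolution M :=
  have w : C.d 1 0 ≫ ModuleCat.ofHom ε = 0 := by
    ext x
    exact hε.apply_apply_eq_zero x
  { complex := C
    projective := fun n => by
      have := hC n
      exact (IsProjective.iff_projective (C.X n)).1 this
    π := (ChainComplex.toSingle₀Equiv _ _).symm ⟨ModuleCat.ofHom ε, w⟩
    quasiIso := ⟨fun n => by
      cases n with
      | zero =>
        rw [ChainComplex.quasiIsoAt₀_iff, ShortComplex.quasiIso_iff_of_zeros']
        · have hS : (ShortComplex.mk _ _ w).Exact ∧ Epi (ModuleCat.ofHom ε) :=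
            ⟨(ShortComplex.ShortExact.moduleCat_exact_iff_function_exact _).2 hε,
              (ModuleCat.epi_iff_surjective _).2 hs⟩
          refine (ShortComplex.exact_and_epi_g_iff_of_iso ?_).2 hS
          exact ShortComplex.isoMk (Iso.refl _) (Iso.refl _) (Iso.refl _)
            ((Category.id_comp _).trans (Category.comp_id _).symm) (by
              simp only [HomologicalComplex.shortComplexFunctor'_map_τ₂,
                ChainComplex.toSingle₀Equiv_symm_apply_f_zero]
              exact (Category.id_comp _).trans (Category.comp_id _).symm)
        · exact C.shape _ _ (by simp)
        all_goals rfl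
      | succ n =>
        rw [quasiIsoAt_iff_exactAt']
        · rw [HomologicalComplex.exactAt_iff' _ (n + 1 + 1) (n + 1) n (by simp) (by simp)]
          exact (ShortComplex.ShortExact.moduleCat_exact_iff_function_exact _).2 (hd n)
        · apply ChainComplex.exactAt_succ_single_obj⟩ }

end Resolution

/-! ### Minimality and uniqueness over a local ring. -/

section Minimal

variable {R : Type u} [CommRing R] [IsLocalRing R]

/-- Nakayama gives surjectivity, and a surjective endomorphism of a finite module is injective. -/
theorem bijective_of_sub_id_mem {P : Type u} [AddCommGroup P] [Module R P] [Module.Finite R P]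
    (φ : P →ₗ[R] P) (h : ∀ x, φ x - x ∈ IsLocalRing.maximalIdeal R • (⊤ : Submodule R P)) :
    Function.Bijective φ := by
  have hs : Function.Surjective φ := by
    rw [← LinearMap.range_eq_top, eq_top_iff]
    refine Submodule.le_of_le_smul_of_le_jacobson_bot Module.Finite.fg_top
      (IsLocalRing.maximalIdeal_le_jacobson ⊥) fun x _ => ?_
    rw [← sub_sub_cancel (φ x) x]
    exact Submodule.sub_mem _ (Submodule.mem_sup_left ⟨x, rfl⟩) (Submodule.mem_sup_right (h x))
  exact ⟨OrzechProperty.injective_of_surjective_endomorphism φ hs, hs⟩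

theorem map_smul_top_le {P Q : Type u} [AddCommGroup P] [Module R P] [AddCommGroup Q] [Module R Q]
    (f : P →ₗ[R] Q) {x : P} (hx : x ∈ IsLocalRing.maximalIdeal R • (⊤ : Submodule R P)) :
    f x ∈ IsLocalRing.maximalIdeal R • (⊤ : Submodule R Q) := by
  have := Submodule.mem_map_of_mem (f := f) hx
  rw [Submodule.map_smul''] at this
  exact Submodule.smul_mono le_rfl le_top this

/-- The kernel of a projective cover is unique. -/
theorem IsShortExact.nonempty_equiv_of_minimal {A P C A' P' : Type u} [AddCommGroup A]
    [Module R A] [AddCommGroup P] [Module R P] [AddCommGroup C] [Module R C] [AddCommGroup A']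
    [Module R A'] [AddCommGroup P'] [Module R P'] [Module.Finite R P] [Module.Projective R P]
    [Module.Finite R P'] [Module.Projective R P'] {f : A →ₗ[R] P} {g : P →ₗ[R] C}
    {f' : A' →ₗ[R] P'} {g' : P' →ₗ[R] C} (h : IsShortExact f g) (h' : IsShortExact f' g')
    (hf : LinearMap.range f ≤ IsLocalRing.maximalIdeal R • ⊤)
    (hf' : LinearMap.range f' ≤ IsLocalRing.maximalIdeal R • ⊤) :
    Nonempty (A ≃ₗ[R] A') := by
  obtain ⟨φ, hφ⟩ := Module.projective_lifting_property g' g h'.surj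
  obtain ⟨ψ, hψ⟩ := Module.projective_lifting_property g g' h.surj
  have hφ' : ∀ x, g' (φ x) = g x := fun x => LinearMap.congr_fun hφ x
  have hψ' : ∀ x, g (ψ x) = g' x := fun x => LinearMap.congr_fun hψ x
  -- Both maps lie over `C`, so the composite differs from the identity by values in `ker g`, which
  -- lies in `𝔪P`.
  have h1 := bijective_of_sub_id_mem (ψ ∘ₗ φ) fun x =>
    hf ((h.exact _).1 (by simp [hφ', hψ']))
  have h2 := bijective_of_sub_id_mem (φ ∘ₗ ψ) fun x =>
    hf' ((h'.exact _).1 (by simp [hφ', hψ']))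
  let e := LinearEquiv.ofBijective φ ⟨.of_comp (f := ψ) h1.1, .of_comp (g := ψ) h2.2⟩
  have he : (LinearMap.range f).map (e : P →ₗ[R] P') = LinearMap.range f' := by
    rw [← LinearMap.exact_iff.1 h.exact, ← LinearMap.exact_iff.1 h'.exact]
    ext y
    constructor
    · rintro ⟨x, hx, rfl⟩
      exact (hφ' x).trans hx
    · intro hy
      obtain ⟨x, rfl⟩ := e.surjective y
      exact ⟨x, (hφ' x).symm.trans hy, rfl⟩
  exact ⟨LinearEquiv.ofInjective f h.inj ≪≫ₗ e.ofSubmodules _ _ he ≪≫ₗ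
    (LinearEquiv.ofInjective f' h'.inj).symm⟩

theorem IsShortExact.nonempty_equiv_of_stablyIsomorphic {A P C A' P' C' : Type u} [AddCommGroup A]
    [Module R A] [AddCommGroup P] [Module R P] [AddCommGroup C] [Module R C] [AddCommGroup A']
    [Module R A'] [AddCommGroup P'] [Module R P'] [AddCommGroup C'] [Module R C']
    [Module.Finite R P] [Module.Projective R P]
    [Module.Finite R P'] [Module.Projective R P'] {f : A →ₗ[R] P} {g : P →ₗ[R] C}
    {f' : A' →ₗ[R] P'} {g' : P' →ₗ[R] C'} (h : IsShortExact f g) (h' : IsShortExact f' g')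
    (hf : LinearMap.range f ≤ IsLocalRing.maximalIdeal R • ⊤)
    (hf' : LinearMap.range f' ≤ IsLocalRing.maximalIdeal R • ⊤)
    (hC : StablyIsomorphic R C C') :
    Nonempty (A ≃ₗ[R] A') := by
  obtain ⟨Q, _, _, Q', _, _, _, _, _, _, ⟨e⟩⟩ := hC.exists_equiv
  refine ((h.prodMap_id Q).equiv_comp e).nonempty_equiv_of_minimal (h'.prodMap_id Q') ?_ ?_
  · rintro _ ⟨x, rfl⟩
    exact map_smul_top_le (LinearMap.inl R P Q) (hf ⟨x, rfl⟩)
  · rintro _ ⟨x, rfl⟩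
    exact map_smul_top_le (LinearMap.inl R P' Q') (hf' ⟨x, rfl⟩)

variable {M : ModuleCat.{u} R} {F F' : ProjectiveResolution M}

/-- Kernels of projective covers ignore projective summands of the target, so one more syzygy
upgrades stable isomorphism to isomorphism. -/
theorem nonempty_syzygy_succ_equiv (hF : IsMinimalFree F) {m n : ℕ}
    (h : StablyIsomorphic R (Syzygy F m) (Syzygy F n)) :
    Nonempty (Syzygy F (m + 1) ≃ₗ[R] Syzygy F (n + 1)) := by
  have := hF.finite m
  have := hF.finite n
  have := module_projective F m
  have := module_projective F n
  refine (isShortExact_syzygy F m).nonempty_equiv_of_stablyIsomorphic (isShortExact_syzygy F n)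
    ?_ ?_ h
  · rw [range_syzygyInclusion]
    exact hF.minimal m
  · rw [range_syzygyInclusion]
    exact hF.minimal n

/-- Both homotopy terms take values in `𝔪` times the module because the differentials do. -/
theorem bijective_of_homotopy_id {C : ChainComplex (ModuleCat.{u} R) ℕ}
    (hfin : ∀ n, Module.Finite R (C.X n))
    (hmin : ∀ n, LinearMap.range (C.d (n + 1) n).hom ≤ IsLocalRing.maximalIdeal R • ⊤)
    {φ : C ⟶ C}
    (h : Homotopy φ (𝟙 C)) (n : ℕ) : Function.Bijective (φ.f n).hom := by
  have := hfin n
  refine bijective_of_sub_id_mem _ fun x => ?_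
  have hn := h.comm n
  have h1 : ∀ x, (dNext n h.hom).hom x ∈
      IsLocalRing.maximalIdeal R • (⊤ : Submodule R (C.X n)) := by
    intro x
    cases n with
    | zero => simp
    | succ n =>
      rw [Homotopy.dNext_succ_chainComplex]
      exact map_smul_top_le (h.hom n (n + 1)).hom (hmin n ⟨x, rfl⟩)
  have h2 : ∀ x, (prevD n h.hom).hom x ∈
      IsLocalRing.maximalIdeal R • (⊤ : Submodule R (C.X n)) := by
    intro x
    rw [Homotopy.prevD_chainComplex]
    exact hmin n ⟨_, rfl⟩
  have : (φ.f n).hom x = (dNext n h.hom).hom x + (prevD n h.hom).hom x + x := by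
    rw [hn]; rfl
  rw [this, add_sub_cancel_right]
  exact add_mem (h1 x) (h2 x)

/-- Minimal free resolutions are unique up to isomorphism. -/
theorem nonempty_iso_of_isMinimalFree (hF : IsMinimalFree F) (hF' : IsMinimalFree F') :
    Nonempty (F.complex ≅ F'.complex) := by
  let e := ProjectiveResolution.homotopyEquiv F F'
  have h1 := bijective_of_homotopy_id hF.finite hF.minimal e.homotopyHomInvId
  have h2 := bijective_of_homotopy_id hF'.finite hF'.minimal e.homotopyInvHomId
  have : ∀ n, IsIso (e.hom.f n) := fun n => by
    rw [ConcreteCategory.isIso_iff_bijective]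
    constructor
    · exact Function.Injective.of_comp (f := (e.inv.f n).hom) (h1 n).1
    · exact Function.Surjective.of_comp (g := (e.inv.f n).hom) (h2 n).2
  have := HomologicalComplex.Hom.isIso_of_components e.hom
  exact ⟨asIso e.hom⟩

end Minimal

/-! ### Eventually periodic complexes. -/

section Periodic

variable {R : Type u} [CommRing R]

theorem nonempty_coker_equiv_of_iso {C D : ChainComplex (ModuleCat.{u} R) ℕ} (φ : C ≅ D) (n : ℕ) :
    Nonempty ((C.X n ⧸ LinearMap.range (C.d (n + 1) n).hom) ≃ₗ[R]
      (D.X n ⧸ LinearMap.range (D.d (n + 1) n).hom)) := by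
  have hc : ∀ x, (φ.hom.f n).hom ((C.d (n + 1) n).hom x) =
      (D.d (n + 1) n).hom ((φ.hom.f (n + 1)).hom x) := fun x =>
    (ConcreteCategory.congr_hom (φ.hom.comm (n + 1) n) x).symm
  let e := fun m => ((HomologicalComplex.eval _ _ m).mapIso φ).toLinearEquiv
  refine ⟨Submodule.Quotient.equiv _ _ (e n) ?_⟩
  ext y
  constructor
  · rintro ⟨_, ⟨x, rfl⟩, rfl⟩
    exact ⟨_, (hc x).symm⟩
  · rintro ⟨x, rfl⟩
    obtain ⟨x, rfl⟩ := (e (n + 1)).surjective x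
    exact ⟨_, ⟨x, rfl⟩, hc x⟩

theorem nonempty_coker_equiv_of_iso_of {C : ChainComplex (ModuleCat.{u} R) ℕ}
    {X : ℕ → ModuleCat.{u} R} {d : ∀ n, X (n + 1) ⟶ X n} {sq : ∀ n, d (n + 1) ≫ d n = 0}
    (φ : C ≅ ChainComplex.of X d sq) (n : ℕ) :
    Nonempty ((C.X n ⧸ LinearMap.range (C.d (n + 1) n).hom) ≃ₗ[R]
      (X n ⧸ LinearMap.range (d n).hom)) := by
  rw [← ChainComplex.of_d X d n]
  exact nonempty_coker_equiv_of_iso φ n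

variable (C : ChainComplex (ModuleCat.{u} R) ℕ) (n a : ℕ) (e : C.X n ⟶ C.X (n + a - 1))

/-- The differential of the periodic complex between terms of indices `p` and `q`. -/
def gluedD (p q : ℕ) : C.X p ⟶ C.X q :=
  if h : p = n ∧ q = n + a - 1 then
    eqToHom (congrArg C.X h.1) ≫ e ≫ eqToHom (congrArg C.X h.2.symm)
  else C.d p q

/-- With `p` and `q` free, equalities of indices can be substituted despite the dependent types. -/
theorem periodicD_eq_gluedD (k : ℕ) :
    periodicD C n a e k = gluedD C n a e (periodicIndex n a (k + 1)) (periodicIndex n a k) := rfl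

theorem gluedD_glue : gluedD C n a e n (n + a - 1) = e := by
  simp [gluedD]

variable {a} in
theorem gluedD_succ (ha : 0 < a) (q : ℕ) : gluedD C n a e (q + 1) q = C.d (q + 1) q :=
  dif_neg (by lia)

theorem nonempty_coker_gluedD_equiv {p q p' q' : ℕ} (hp : p = p') (hq : q = q') :
    Nonempty ((C.X q ⧸ LinearMap.range (gluedD C n a e p q).hom) ≃ₗ[R]
      (C.X q' ⧸ LinearMap.range (gluedD C n a e p' q').hom)) := by
  subst hp hq
  exact ⟨.refl R _⟩

theorem periodicIndex_add {n k : ℕ} (hk : n ≤ k) (a : ℕ) :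
    periodicIndex n a (k + a) = periodicIndex n a k := by
  rw [periodicIndex, periodicIndex, if_neg (by lia), if_neg (by lia),
    show k + a - n = k - n + a by lia, Nat.add_mod_right]

theorem periodicIndex_of_le {n a k : ℕ} (hk : k ≤ n) : periodicIndex n a k = k := by
  unfold periodicIndex
  split_ifs with h
  · rfl
  · obtain rfl : k = n := by lia
    simp

theorem periodicIndex_succ {a : ℕ} (ha : 0 < a) (n k : ℕ) :
    periodicIndex n a (k + 1) = periodicIndex n a k + 1 ∨
      periodicIndex n a (k + 1) = n ∧ periodicIndex n a k = n + a - 1 := by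
  rcases lt_or_ge k n with hk | hk
  · left
    rw [periodicIndex_of_le hk, periodicIndex_of_le hk.le]
  · have h : k + 1 - n = k - n + 1 := by lia
    have hlt := Nat.mod_lt (k - n) ha
    rw [periodicIndex, periodicIndex, if_neg (by lia), if_neg (by lia), h]
    by_cases hm : (k - n) % a + 1 = a
    · right
      have : (k - n + 1) % a = 0 := by
        rw [← Nat.mod_add_mod, hm, Nat.mod_self]
      exact ⟨by lia, by lia⟩
    · left
      rw [Nat.add_mod_of_add_mod_lt]
      · have : 1 % a = 1 := Nat.mod_eq_of_lt (by lia)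
        lia
      · have : 1 % a = 1 := Nat.mod_eq_of_lt (by lia)
        lia

/-- From `n` on, the model complex has the same differential at `k` and `k + a`. -/
theorem IsEventuallyPeriodic.exists_coker_equiv {C : ChainComplex (ModuleCat.{u} R) ℕ} {a : ℕ}
    (h : IsEventuallyPeriodic C a) : ∃ n, ∀ k, n ≤ k →
      Nonempty ((C.X k ⧸ LinearMap.range (C.d (k + 1) k).hom) ≃ₗ[R]
        (C.X (k + a) ⧸ LinearMap.range (C.d (k + a + 1) (k + a)).hom)) := by
  obtain ⟨ha, n, e, sq, ⟨φ⟩⟩ := h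
  refine ⟨n, fun k hk => ?_⟩
  obtain ⟨e₁⟩ := nonempty_coker_equiv_of_iso_of φ k
  obtain ⟨e₂⟩ := nonempty_coker_equiv_of_iso_of φ (k + a)
  have h1 := periodicIndex_add hk a
  have h2 := periodicIndex_add (k := k + 1) (by lia : n ≤ k + 1) a
  obtain ⟨e₃⟩ := nonempty_coker_gluedD_equiv C n a e (add_right_comm k 1 a ▸ h2.symm) h1.symm
  exact ⟨e₁ ≪≫ₗ e₃ ≪≫ₗ e₂.symm⟩

section Construction

variable {C n a e}

theorem range_gluedD (ha : 0 < a)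
    (hrange : LinearMap.range e.hom = LinearMap.range (C.d (n + a - 1 + 1) (n + a - 1)).hom)
    {p q : ℕ} (h : p = q + 1 ∨ p = n ∧ q = n + a - 1) :
    LinearMap.range (gluedD C n a e p q).hom = LinearMap.range (C.d (q + 1) q).hom := by
  rcases h with rfl | ⟨rfl, rfl⟩
  · rw [gluedD_succ C n e ha]
  · rw [gluedD_glue, hrange]

theorem ker_gluedD (ha : 0 < a)
    (hd : ∀ k, Function.Exact (C.d (k + 2) (k + 1)).hom (C.d (k + 1) k).hom)
    (hker : LinearMap.ker e.hom = LinearMap.range (C.d (n + 1) n).hom)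
    {p q : ℕ} (h : p = q + 1 ∨ p = n ∧ q = n + a - 1) :
    LinearMap.ker (gluedD C n a e p q).hom = LinearMap.range (C.d (p + 1) p).hom := by
  rcases h with rfl | ⟨rfl, rfl⟩
  · rw [gluedD_succ C n e ha, LinearMap.exact_iff.1 (hd q)]
  · rw [gluedD_glue, hker]

/-- The image of a glued differential depends only on its target index and the kernel only on its
source index, so exactness at each term is inherited from `C`. -/
theorem exact_periodicD (ha : 0 < a)
    (hd : ∀ k, Function.Exact (C.d (k + 2) (k + 1)).hom (C.d (k + 1) k).hom)
    (hker : LinearMap.ker e.hom = LinearMap.range (C.d (n + 1) n).hom)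
    (hrange : LinearMap.range e.hom = LinearMap.range (C.d (n + a - 1 + 1) (n + a - 1)).hom)
    (k : ℕ) :
    Function.Exact (periodicD C n a e (k + 1)).hom (periodicD C n a e k).hom := by
  rw [LinearMap.exact_iff, periodicD_eq_gluedD, periodicD_eq_gluedD,
    ker_gluedD ha hd hker (periodicIndex_succ ha n k),
    range_gluedD ha hrange (periodicIndex_succ ha n (k + 1))]

end Construction

variable [IsLocalRing R]

theorem IsMinimalFree.isEventuallyPeriodic {M : ModuleCat.{u} R} {F : ProjectiveResolution M}
    (hF : IsMinimalFree F) {n a : ℕ} (hn : 0 < n) (ha : 0 < a)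
    (h : Nonempty (Syzygy F n ≃ₗ[R] Syzygy F (n + a))) : IsEventuallyPeriodic F.complex a := by
  obtain ⟨r, hr⟩ : ∃ r, r + 1 = n + a := ⟨n + a - 1, by lia⟩
  obtain rfl : r = n + a - 1 := by lia
  rw [← hr] at h
  obtain ⟨φ⟩ := h
  -- The gluing map projects onto the `n`-th syzygy, applies the isomorphism and includes the `(n +
  -- a)`-th syzygy into its free cover.
  let e : F.complex.X n ⟶ F.complex.X (n + a - 1) := ModuleCat.ofHom
    (syzygyInclusion F (n + a - 1) ∘ₗ φ.toLinearMap ∘ₗ Submodule.mkQ _)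
  have hker : LinearMap.ker e.hom = LinearMap.range (F.complex.d (n + 1) n).hom := by
    simp only [e, ModuleCat.hom_ofHom]
    rw [LinearMap.ker_comp_of_ker_eq_bot _
      (LinearMap.ker_eq_bot.2 (isShortExact_syzygy F (n + a - 1)).inj),
      LinearMap.ker_comp_of_ker_eq_bot _ φ.ker, Submodule.ker_mkQ]
  have hrange : LinearMap.range e.hom =
      LinearMap.range (F.complex.d (n + a - 1 + 1) (n + a - 1)).hom := by
    simp only [e, ModuleCat.hom_ofHom]
    rw [LinearMap.range_comp_of_range_eq_top, range_syzygyInclusion]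
    rw [LinearMap.range_comp_of_range_eq_top _ (Submodule.range_mkQ _), LinearEquiv.range]
  have hex := exact_periodicD ha (exact_d F) hker hrange
  have sq : ∀ k, periodicD F.complex n a e (k + 1) ≫ periodicD F.complex n a e k = 0 := by
    intro k
    ext x
    exact (hex k).apply_apply_eq_zero x
  let P := ChainComplex.of (fun k => F.complex.X (periodicIndex n a k))
    (periodicD F.complex n a e) sq
  have hPd : ∀ k, P.d (k + 1) k = periodicD F.complex n a e k := fun k =>
    ChainComplex.of_d (fun k => F.complex.X (periodicIndex n a k)) _ k
  -- As `n > 0`, the first differential is unchanged, so the spliced complex still resolves `M`.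
  have h0 : periodicIndex n a 0 = 0 := periodicIndex_of_le hn.le
  have h1 : periodicIndex n a 1 = 1 := periodicIndex_of_le hn
  have haug : ∃ ε : F.complex.X (periodicIndex n a 0) →ₗ[R] M,
      Function.Exact (periodicD F.complex n a e 0).hom ε ∧ Function.Surjective ε := by
    rw [periodicD_eq_gluedD]
    generalize periodicIndex n a 0 = p at h0
    generalize periodicIndex n a (0 + 1) = q at h1
    subst h0 h1
    rw [gluedD_succ F.complex n e ha 0]
    exact ⟨augmentation F, exact_augmentation F, augmentation_surjective F⟩
  obtain ⟨ε, hε, hs⟩ := haug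
  let F' : ProjectiveResolution M := resolutionOfExact P (fun k => module_projective F _)
    (fun k => by rw [hPd, hPd]; exact hex k) ε (by rw [hPd]; exact hε) hs
  have hF' : IsMinimalFree F' := by
    refine ⟨fun k => hF.free _, fun k => hF.finite _, fun k => ?_⟩
    change LinearMap.range (P.d (k + 1) k).hom ≤ _
    rw [hPd, periodicD_eq_gluedD, range_gluedD ha hrange (periodicIndex_succ ha n k)]
    exact hF.minimal _
  exact ⟨ha, n, e, sq, nonempty_iso_of_isMinimalFree hF hF'⟩

end Periodic

/-! ### Duality between the syzygies of `M` and `N`. -/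

section Duality

variable {R : Type u} [CommRing R] [IsNoetherianRing R]
variable (T S : ℕ → Type u) [∀ k, AddCommGroup (T k)] [∀ k, Module R (T k)]
    [∀ k, AddCommGroup (S k)] [∀ k, Module R (S k)]

/-- The syzygies of `M` and of `N = Extᵍ(M, R)` are dual to each other when `M` is G-perfect of
grade `g`: for `i ≥ g`, the module `(Ωⁱ N)*` is totally reflexive and its `i`-th syzygy is
`Ωᵍ M`. -/
theorem isSyzN_dual_syzygy {g : ℕ} (hT : ∀ k, IsSyz R (T (k + 1)) (T k))
    (hS : ∀ k, IsSyz R (S (k + 1)) (S k))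
    (hg : ∀ i < g, Subsingleton (ExtMod R (T 0) R i)) (hTg : IsTotallyReflexive R (T g))
    (e : S 0 ≃ₗ[R] ExtMod R (T 0) R g) {i : ℕ} (hi : g ≤ i) :
    IsTotallyReflexive R (Module.Dual R (S i)) ∧ IsSyzN R (T g) i (Module.Dual R (S i)) := by
  obtain ⟨B, _, _, f, p, hB, h⟩ := exists_isShortExact_ext T hT hg
  have h0 := isSyzN_of_chain S hS 0 g
  rw [zero_add] at h0
  -- The `g`-th syzygy of `N` is also one of the dual of `T g`.
  have hg := hB.isSyzN h (h0.congr_right (.of_equiv e))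
  have hSg := hg.isTotallyReflexive hTg.dual
  obtain ⟨l, rfl⟩ := Nat.exists_eq_add_of_le hi
  have hl := isSyzN_of_chain S hS g l
  have := hTg.isReflexive
  exact ⟨(hl.isTotallyReflexive hSg).dual,
    ((hg.dual hTg.dual).congr_left (.of_equiv (Module.evalEquiv R (T g)))).trans (hl.dual hSg)⟩

end Duality

end GPerfect

end

/-! ### Assembly of the two parts. -/

theorem theorem1p3 {R : Type u} [CommRing R] [IsLocalRing R] [IsNoetherianRing R]
    (M : Type u) [AddCommGroup M] [Module R M] [Module.Finite R M]
    (g : ℕ) (hM : GPerfect.IsGPerfect R M) (hg : GPerfect.grade R M = g)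
    (F : ProjectiveResolution (ModuleCat.of R M)) (hF : GPerfect.IsMinimalFree F)
    (G : ProjectiveResolution (ModuleCat.of R (GPerfect.ExtMod R M R g)))
    (hG : GPerfect.IsMinimalFree G) :
    (∀ a : ℕ, GPerfect.IsEventuallyPeriodic F.complex a →
      ∀ i m : ℕ, g ≤ i → (i : ℚ) / a ≤ m →
        GPerfect.StablyIsomorphic R (Module.Dual R (GPerfect.Syzygy G i))
          (GPerfect.Syzygy F (g + m * a - i))) ∧
    (∀ i j : ℕ, g ≤ i → g < i + j →
      GPerfect.StablyIsomorphic R (Module.Dual R (GPerfect.Syzygy G i)) (GPerfect.Syzygy F j) →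
        GPerfect.IsEventuallyPeriodic F.complex (i + j - g)) := by
  open GPerfect in
  have hT := isSyz_syzygy F hF.finite
  have hS := isSyz_syzygy G hG.finite
  have e₀ : Syzygy F 0 ≃ₗ[R] M := syzygyZeroEquiv F
  have hTn (m n : ℕ) : IsSyzN R (Syzygy F (m + n)) n (Syzygy F m) :=
    isSyzN_of_chain (fun k => Syzygy F k) hT m n
  have hTg : IsTotallyReflexive R (Syzygy F g) := by
    have := hTn 0 g
    rw [zero_add] at this
    exact (gdimLE_of_gdim_eq (hM.2.symm.trans hg)).isTotallyReflexive
      (this.congr_right (.of_equiv e₀))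
  have hTk : ∀ k, g ≤ k → IsTotallyReflexive R (Syzygy F k) := by
    intro k hk
    obtain ⟨l, rfl⟩ := Nat.exists_eq_add_of_le hk
    exact (hTn g l).isTotallyReflexive hTg
  have hext : ∀ i < g, Subsingleton (ExtMod R (Syzygy F 0) R i) := fun i hi =>
    ext_congr e₀ i (subsingleton_ext_of_lt_grade (by rw [hg]; exact_mod_cast hi))
  have hdual {i : ℕ} (hi : g ≤ i) := isSyzN_dual_syzygy (fun k => Syzygy F k)
    (fun k => Syzygy G k) hT hS hext hTg (syzygyZeroEquiv G ≪≫ₗ (extCongr e₀ g).symm) hi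
  refine ⟨fun a ha i m hi hm => ?_, fun i j hi hij h => ?_⟩
  · have ha0 : 0 < a := ha.1
    have him : i ≤ m * a := by
      rw [div_le_iff₀ (by exact_mod_cast ha0)] at hm
      exact_mod_cast hm
    obtain ⟨n, hn⟩ := ha.exists_coker_equiv
    have hstep : ∀ k, g ≤ k → StablyIsomorphic R (Syzygy F k) (Syzygy F (k + a)) := by
      intro k hk
      -- Moving `n` steps further reaches the periodic range; total reflexivity then cancels those
      -- `n` syzygies.
      obtain ⟨e⟩ := hn (k + n) (Nat.le_add_left n k)
      refine (hTn k n).stablyIsomorphic_right (hTn (k + a) n) (hTk k hk) (hTk _ (by lia)) ?_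
      rw [add_right_comm k a n]
      exact .of_equiv e
    have hper : ∀ m, StablyIsomorphic R (Syzygy F g) (Syzygy F (g + m * a)) := by
      intro m
      induction m with
      | zero => rw [zero_mul, add_zero]; exact .refl R _
      | succ m ih =>
        rw [Nat.succ_mul, ← add_assoc]
        exact ih.trans (hstep _ (Nat.le_add_right _ _))
    -- Since `i ≤ m * a`, the subtraction is not truncated and the index is at least `g`, so this
    -- syzygy is totally reflexive.
    have hi' := hTn (g + m * a - i) i
    rw [Nat.sub_add_cancel (by lia)] at hi'
    exact (hdual hi).2.stablyIsomorphic_right hi' (hdual hi).1 (hTk _ (by lia)) (hper m)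
  -- Only uniqueness of syzygies is used here, so `j` may be smaller than `g`.
  · have hs := (hdual hi).2.stablyIsomorphic (hTn j i) h
    obtain ⟨a, ha⟩ : ∃ a, j + i = g + a := ⟨i + j - g, by lia⟩
    obtain rfl : i + j - g = a := by lia
    rw [ha] at hs
    -- The periodic part starts at `g + 1`, which is positive even when `g = 0`.
    obtain ⟨e⟩ := nonempty_syzygy_succ_equiv hF hs
    rw [add_right_comm] at e
    exact hF.isEventuallyPeriodic (Nat.succ_pos g) (by lia) ⟨e⟩
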